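/- Write $x\ll y$ in a partially ordered set if, for every increasing sequence $(z_k)_k$ with a supremum such that $y\le\sup_k z_k$, one has $x\le z_k$ for some $k$. A $\mathrm{Cu}$-semigroup is a positively ordered commutative monoid such that (O1) increasing sequences have suprema, (O2) every element is the supremum of a $\ll$-increasing sequence, (O3) $x'\ll x$ and $y'\ll y$ imply $x'+y'\ll x+y$, and (O4) suprema of increasing sequences are compatible with addition. $\mathrm{Cu}$ is the category of $\mathrm{Cu}$-semigroups, with morphisms the monoid morphisms that preserve the order, $\ll$, and suprema of increasing sequences. A $\mathrm{Cu}$-semigroup is countably-based if it has a countable subset $B$ such that every element is the supremum of an increasing sequence in $B$. For $\mathrm{Cu}$-morphisms $\alpha,\beta\colon S\to T$ and a finite set $F\subseteq S$, write $\alpha\simeq_F\beta$ if $\alpha(x')\le\beta(x)$ and $\beta(x')\le\alpha(x)$ for all $x',x\in F$ with $x'\ll x$. A subcategory $\mathfrak c$ of $\mathrm{Cu}$ is a (Cuntz) Fraïssé category if: (JEP) for all $A_1,A_2\in\mathfrak c$ there is $B\in\mathfrak c$ with $\mathrm{Hom}_{\mathfrak c}(A_i,B)\neq\emptyset$ for $i=1,2$;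 (NAP) for all $\mathfrak c$-morphisms $\alpha_i\colon A\to B_i$ $(i=1,2)$ and all finite $F\subseteq A$ there are $\mathfrak c$-morphisms $\beta_i\colon B_i\to C$ with $\beta_1\alpha_1\simeq_F\beta_2\alpha_2$; (SEP) there is a subcategory $\mathfrak s\subseteq\mathfrak c$ with countably-based objects and countably many morphisms such that every $A\in\mathfrak c$ has a $\mathfrak c$-morphism to some $S\in\mathfrak s$, and for every $\mathfrak c$-morphism $\sigma\colon S\to A$ with $S\in\mathfrak s$ and every finite $F\subseteq S$ there are a $\mathfrak c$-morphism $\alpha\colon A\to T$ and an $\mathfrak s$-morphism $\tau\colon S\to T$ with $\alpha\sigma\simeq_F\tau$. A (Cuntz) Fraïssé sequence in $\mathfrak c$ is an inductive sequence $(S_i,\sigma_{i,j})_{i\in\mathbb N}$ in $\mathfrak c$ of countably-based $\mathrm{Cu}$-semigroups such that, for every $i$, every finite $F\subseteq S_i$ and every $\mathfrak c$-morphism $\alpha\colon S_i\to C$, there are $j\ge i$ and a $\mathfrak c$-morphism $\beta\colon C\to S_j$ with $\beta\alpha\simeq_F\sigma_{i,j}$. A Fraïssé limit of $\mathfrak c$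 is the inductive limit in $\mathrm{Cu}$ of a Fraïssé sequence in $\mathfrak c$. For $m\ge1$ let $E_m=\{0,1,\dots,m,\infty\}$ with its natural total order, where the sum of two elements is the usual one if it is at most $m$ and is $\infty$ otherwise. For $n\ge 2$ let $\mathfrak e_n$ be the subcategory of $\mathrm{Cu}$ whose objects are the $E_{n^k}$, $k\in\mathbb N=\{0,1,2,\dots\}$, and whose morphisms are those $\mathrm{Cu}$-morphisms $E_{n^k}\to E_{n^s}$ that are order-embeddings and satisfy $1\mapsto n^r\cdot 1$ for some $r\in\mathbb N$. Corollary. Let $n\ge 2$. The category $\mathfrak e_n$ is a Fraïssé category; it has a Fraïssé limit $\mathcal E_n$, which is unique up to isomorphism in $\mathrm{Cu}$; and $\mathcal E_n$ is a $\mathrm{Cu}$-semigroup that is - simple: it is nonzero, and its only ideals (submonoids that are downward closed and closed under suprema of increasing sequences) are $\{0\}$ and $\mathcal E_n$; - totally ordered; - not stably finite, where $S$ is stably finite if $x\neq x+y$ for all $x,y\in S$ such that $y\ne 0$ and $x\ll z$ for some $z\in S$; - not weakly purely infinite, where $S$ is weakly purely infinite if there is an integer $m\ge1$ with $mx=2(mx)$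 for every $x\in S$. -/

import Mathlib

open CategoryTheory CategoryTheory.Limits

/-- The sequential way-below (compact containment) relation `x ≪ y`. -/
def CuBelow {P : Type*} [Preorder P] (x y : P) : Prop :=
  ∀ z : ℕ → P, Monotone z → ∀ s, IsLUB (Set.range z) s → y ≤ s → ∃ k, x ≤ z k

/-- Abstract Cuntz semigroups: positively ordered commutative monoids satisfying (O1)-(O4). -/
class CuSemigroup (S : Type*) extends AddCommMonoid S, PartialOrder S, IsOrderedAddMonoid S where
  /-- the order is positive -/
  cu_zero_le : ∀ x : S, 0 ≤ x
  /-- (O1) -/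
  exists_isLUB : ∀ z : ℕ → S, Monotone z → ∃ s, IsLUB (Set.range z) s
  /-- (O2) -/
  exists_below_seq : ∀ x : S, ∃ z : ℕ → S,
    (∀ k, CuBelow (z k) (z (k + 1))) ∧ IsLUB (Set.range z) x
  /-- (O3) -/
  add_below_add : ∀ x' x y' y : S, CuBelow x' x → CuBelow y' y → CuBelow (x' + y') (x + y)
  /-- (O4) -/
  isLUB_add : ∀ z w : ℕ → S, Monotone z → Monotone w → ∀ s t,
    IsLUB (Set.range z) s → IsLUB (Set.range w) t → IsLUB (Set.range fun k => z k + w k) (s + t)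

/-- `Cu`-morphisms: monoid morphisms preserving the order, the relation `≪`, and suprema of
increasing sequences. -/
@[ext]
structure CuHom (S T : Type*) [CuSemigroup S] [CuSemigroup T] extends S →+ T where
  monotone' : Monotone toFun
  map_below' : ∀ x y, CuBelow x y → CuBelow (toFun x) (toFun y)
  map_isLUB' : ∀ z : ℕ → S, Monotone z → ∀ s, IsLUB (Set.range z) s →
    IsLUB (Set.range fun k => toFun (z k)) (toFun s)

namespace CuHom

instance {S T : Type*} [CuSemigroup S] [CuSemigroup T] : FunLike (CuHom S T) S T where
  coe f := f.toFun
  coe_injective f g h := by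
    ext x
    exact congrFun h x

/-- The identity morphism. -/
def id (S : Type*) [CuSemigroup S] : CuHom S S where
  toAddMonoidHom := AddMonoidHom.id S
  monotone' := monotone_id
  map_below' _ _ h := h
  map_isLUB' _ _ _ h := h

/-- Composition: first `f`, then `g`. -/
def comp {S T R : Type*} [CuSemigroup S] [CuSemigroup T] [CuSemigroup R]
    (g : CuHom T R) (f : CuHom S T) : CuHom S R where
  toAddMonoidHom := g.toAddMonoidHom.comp f.toAddMonoidHom
  monotone' := g.monotone'.comp f.monotone'
  map_below' x y h := g.map_below' _ _ (f.map_below' x y h)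
  map_isLUB' z hz s h := g.map_isLUB' _ (f.monotone'.comp hz) _ (f.map_isLUB' z hz s h)

end CuHom

/-- Bundled `Cu`-semigroups. -/
structure CuSg where
  carrier : Type
  [str : CuSemigroup carrier]

instance : CoeSort CuSg Type := ⟨CuSg.carrier⟩

instance (S : CuSg) : CuSemigroup S := S.str

/-- The category `Cu` of `Cu`-semigroups and `Cu`-morphisms. -/
instance : Category CuSg where
  Hom S T := CuHom S T
  id S := CuHom.id S
  comp f g := CuHom.comp g f

/-! ### Properties of `Cu`-semigroups -/

/-- `S` has a countable subset `B` such that every element of `S` is the supremum of an increasing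
sequence in `B`. -/
def CountablyBased (S : Type*) [CuSemigroup S] : Prop :=
  ∃ B : Set S, B.Countable ∧
    ∀ x : S, ∃ z : ℕ → S, Monotone z ∧ (∀ k, z k ∈ B) ∧ IsLUB (Set.range z) x

/-- Ideals of a `Cu`-semigroup: submonoids that are downward closed and closed under suprema of
increasing sequences. -/
structure IsCuIdeal {S : Type*} [CuSemigroup S] (I : Set S) : Prop where
  zero_mem : 0 ∈ I
  add_mem : ∀ x ∈ I, ∀ y ∈ I, x + y ∈ I
  lower : ∀ x y, x ≤ y → y ∈ I → x ∈ I
  sup_mem : ∀ z : ℕ → S, Monotone z → (∀ k, z k ∈ I) → ∀ s, IsLUB (Set.range z) s → s ∈ I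

/-- `S` is simple: it is nonzero and its only ideals are `{0}` and `S`. -/
def IsCuSimple (S : Type*) [CuSemigroup S] : Prop :=
  Nontrivial S ∧ ∀ I : Set S, IsCuIdeal I → I = {0} ∨ I = Set.univ

/-- `S` is stably finite: `x ≠ x + y` for all nonzero `y` whenever `x ≪ z` for some `z`. -/
def IsStablyFinite (S : Type*) [CuSemigroup S] : Prop :=
  ∀ x : S, (∃ z, CuBelow x z) → ∀ y : S, y ≠ 0 → x ≠ x + y

/-- `S` is weakly purely infinite: for some `m ≥ 1` one has `m x = 2 (m x)` for all `x`. -/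
def IsWeaklyPurelyInfinite (S : Type*) [CuSemigroup S] : Prop :=
  ∃ m : ℕ, 1 ≤ m ∧ ∀ x : S, m • x = 2 • (m • x)

/-! ### Cuntz Fraïssé theory

A subcategory of `Cu` is presented by a category `C` with its (faithful) inclusion functor
`U : C ⥤ CuSg`. -/

/-- `α` and `β` compare on the finite set `F`, written `α ≃_F β`. -/
def CompareOn {S T : Type*} [CuSemigroup S] [CuSemigroup T] (F : Finset S)
    (α β : CuHom S T) : Prop :=
  ∀ x' ∈ F, ∀ x ∈ F, CuBelow x' x → α x' ≤ β x ∧ β x' ≤ α x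

section Fraisse

variable {C : Type} [Category.{0} C] (U : C ⥤ CuSg) [U.Faithful]

/-- The (Cuntz) joint embedding property. -/
def CuJEP : Prop := ∀ A₁ A₂ : C, ∃ B : C, Nonempty (A₁ ⟶ B) ∧ Nonempty (A₂ ⟶ B)

/-- The (Cuntz) near amalgamation property. -/
def CuNAP : Prop :=
  ∀ (A B₁ B₂ : C) (α₁ : A ⟶ B₁) (α₂ : A ⟶ B₂) (F : Finset (U.obj A)),
    ∃ (D : C) (β₁ : B₁ ⟶ D) (β₂ : B₂ ⟶ D),
      CompareOn F (U.map (α₁ ≫ β₁)) (U.map (α₂ ≫ β₂))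

/-- (Cuntz) separability: there is a countable dominating subcategory, with objects `P` and
morphisms `W`. -/
def CuSEP : Prop :=
  ∃ (P : ObjectProperty C) (W : MorphismProperty C),
    (∀ (A B : C) (f : A ⟶ B), W f → P A ∧ P B) ∧
    (∀ A : C, P A → W (𝟙 A)) ∧
    (∀ (A B D : C) (f : A ⟶ B) (g : B ⟶ D), W f → W g → W (f ≫ g)) ∧
    (∀ A : C, P A → CountablyBased (U.obj A)) ∧
    {f : Arrow C | W f.hom}.Countable ∧
    (∀ A : C, ∃ S : C, P S ∧ Nonempty (A ⟶ S)) ∧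
    (∀ (S A : C) (σ : S ⟶ A), P S → ∀ F : Finset (U.obj S),
      ∃ (T : C) (α : A ⟶ T) (τ : S ⟶ T), P T ∧ W τ ∧ CompareOn F (U.map (σ ≫ α)) (U.map τ))

/-- (Cuntz) Fraïssé categories. -/
def IsCuFraisseCategory : Prop := CuJEP (C := C) ∧ CuNAP U ∧ CuSEP U

/-- (Cuntz) Fraïssé sequences, for an inductive sequence `S` in `C`. -/
def IsCuFraisseSequence (S : ℕ ⥤ C) : Prop :=
  (∀ i, CountablyBased (U.obj (S.obj i))) ∧
  ∀ (i : ℕ) (F : Finset (U.obj (S.obj i))) (A : C) (α : S.obj i ⟶ A),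
    ∃ (j : ℕ) (hij : i ≤ j) (β : A ⟶ S.obj j),
      CompareOn F (U.map (α ≫ β)) (U.map (S.map (homOfLE hij)))

/-- `L` is a Fraïssé limit: the inductive limit in `Cu` of some Fraïssé sequence. -/
def IsCuFraisseLimit (L : CuSg) : Prop :=
  ∃ S : ℕ ⥤ C, IsCuFraisseSequence U S ∧
    ∃ ι : S ⋙ U ⟶ (Functor.const ℕ).obj L, Nonempty (IsColimit (Cocone.mk L ι))

end Fraisse

/-! ### The elementary semigroups `E_m` and the category `𝔢_n` -/

/-- `E_m = {0, 1, …, m, ∞}`, the element `∞` being encoded as `m + 1`. -/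
structure ElemSg (m : ℕ) where
  val : ℕ
  le' : val ≤ m + 1

namespace ElemSg

variable {m : ℕ}

theorem val_injective : Function.Injective (val : ElemSg m → ℕ) := by
  rintro ⟨a, _⟩ ⟨b, _⟩ h
  cases h
  rfl

/-- The natural order `0 < 1 < ⋯ < m < ∞`. -/
instance : PartialOrder (ElemSg m) := PartialOrder.lift val val_injective

/-- The sum of two elements is the usual one if that is at most `m`, and `∞` otherwise. -/
instance : Add (ElemSg m) := ⟨fun x y => ⟨min (x.val + y.val) (m + 1), min_le_right _ _⟩⟩

instance : Zero (ElemSg m) := ⟨⟨0, Nat.zero_le _⟩⟩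

instance : One (ElemSg m) := ⟨⟨1, Nat.le_add_left 1 m⟩⟩

theorem le_iff (x y : ElemSg m) : x ≤ y ↔ x.val ≤ y.val := Iff.rfl

theorem val_add (x y : ElemSg m) : (x + y).val = min (x.val + y.val) (m + 1) := rfl

theorem val_zero : (0 : ElemSg m).val = 0 := rfl

instance : AddCommMonoid (ElemSg m) where
  add_assoc x y z := val_injective (by simp only [val_add]; omega)
  zero_add x := val_injective (by have := x.le'; simp only [val_add, val_zero]; omega)
  add_zero x := val_injective (by have := x.le'; simp only [val_add, val_zero]; omega)
  add_comm x y := val_injective (by simp only [val_add]; omega)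
  nsmul := nsmulRec

instance : IsOrderedAddMonoid (ElemSg m) where
  add_le_add_left x y h z := by
    rw [le_iff] at h ⊢
    simp only [val_add]
    omega

/-- A sequence in `E_m` attains its maximum. -/
theorem exists_max_term (z : ℕ → ElemSg m) :
    ∃ k, ∀ l, z l ≤ z k := by
  have hfin : (Set.range fun k => (z k).val).Finite :=
    (Set.finite_Iic (m + 1)).subset (by rintro _ ⟨k, rfl⟩; exact (z k).le')
  obtain ⟨_, ⟨k, rfl⟩, hk⟩ := hfin.exists_maximal (Set.range_nonempty _)
  refine ⟨k, fun l => ?_⟩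
  rcases le_total ((z l).val) ((z k).val) with h | h
  · exact h
  · exact hk ⟨l, rfl⟩ h

theorem exists_eq_of_isLUB (z : ℕ → ElemSg m) (s : ElemSg m)
    (hs : IsLUB (Set.range z) s) : ∃ k, s = z k := by
  obtain ⟨k, hk⟩ := exists_max_term z
  refine ⟨k, le_antisymm (hs.2 ?_) (hs.1 ⟨k, rfl⟩)⟩
  rintro _ ⟨l, rfl⟩
  exact hk l

theorem below_iff (x y : ElemSg m) : CuBelow x y ↔ x ≤ y := by
  constructor
  · intro h
    obtain ⟨_, hk⟩ := h (fun _ => y) monotone_const y (by simp) le_rfl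
    exact hk
  · intro h z hz s hs hy
    obtain ⟨k, rfl⟩ := exists_eq_of_isLUB z s hs
    exact ⟨k, h.trans hy⟩

instance : CuSemigroup (ElemSg m) where
  cu_zero_le x := Nat.zero_le x.val
  exists_isLUB z hz := by
    obtain ⟨k, hk⟩ := exists_max_term z
    refine ⟨z k, ?_, fun b hb => hb ⟨k, rfl⟩⟩
    rintro _ ⟨l, rfl⟩
    exact hk l
  exists_below_seq x := ⟨fun _ => x, fun _ => (below_iff x x).2 le_rfl, by simp⟩
  add_below_add x' x y' y hx hy := by
    rw [below_iff] at *
    exact add_le_add hx hy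
  isLUB_add z w hz hw s t hs ht := by
    obtain ⟨k, rfl⟩ := exists_eq_of_isLUB z s hs
    obtain ⟨l, rfl⟩ := exists_eq_of_isLUB w t ht
    constructor
    · rintro _ ⟨i, rfl⟩
      exact add_le_add (hs.1 ⟨i, rfl⟩) (ht.1 ⟨i, rfl⟩)
    · intro b hb
      refine le_trans ?_ (hb ⟨max k l, rfl⟩)
      exact add_le_add (hz (le_max_left k l)) (hw (le_max_right k l))

end ElemSg

/-- The objects of `𝔢_n`: the semigroups `E_m` for the powers `m = n ^ k`, given by `m`. -/
structure ElemCat (n : ℕ) where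
  size : ℕ
  isPow : ∃ k : ℕ, size = n ^ k

/-- The morphisms of `𝔢_n`: the order-embeddings (`Cu`-morphisms that are order-embeddings) with
`1 ↦ n ^ r · 1` for some `r`. -/
def IsElemMor (n : ℕ) {m l : ℕ} (f : CuHom (ElemSg m) (ElemSg l)) : Prop :=
  (∀ x y, f x ≤ f y ↔ x ≤ y) ∧ ∃ r : ℕ, f 1 = n ^ r • (1 : ElemSg l)

/-- The category `𝔢_n`. -/
instance (n : ℕ) : Category (ElemCat n) where
  Hom A B := {f : CuHom (ElemSg A.size) (ElemSg B.size) // IsElemMor n f}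
  id A := ⟨CuHom.id _, fun _ _ => Iff.rfl, 0, by
    rw [pow_zero, one_smul]
    rfl⟩
  comp f g := ⟨CuHom.comp g.1 f.1, fun x y => (g.2.1 _ _).trans (f.2.1 x y), by
    obtain ⟨r, hr⟩ := f.2.2
    obtain ⟨t, ht⟩ := g.2.2
    refine ⟨r + t, ?_⟩
    change g.1 (f.1 1) = _
    rw [hr, pow_add, mul_smul, ← ht]
    exact map_nsmul g.1.toAddMonoidHom _ _⟩

/-- The inclusion of `𝔢_n` into `Cu`. -/
def elemIncl (n : ℕ) : ElemCat n ⥤ CuSg where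
  obj A := ⟨ElemSg A.size⟩
  map f := f.1

instance (n : ℕ) : (elemIncl n).Faithful where
  map_injective h := Subtype.ext h

/-! Everything rests on a rigidity: `𝔢_n` has at most one morphism between two objects. Let `f : E_m
→ E_l` be a morphism with `f 1 = n ^ r • 1`. Since `∞ + 1 = ∞` and `f 1 ≠ 0`, also `f ∞ = ∞`. As `f`
is an order-embedding, `f m < f ∞`. Hence `m * n ^ r ≤ l < (m + 1) * n ^ r`, and since `m` and `l`
are powers of `n`, this forces `l = m * n ^ r`. So `f` is multiplication by `l / m`
(`exists_scale_of_isElemMor`, `hom_unique`), and `𝔢_n` is equivalent to the ordered set `ℕ`.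

The Fraïssé axioms then hold trivially, because diagrams commute automatically. A Fraïssé sequence
is cofinal in `𝔢_n` (`final_of_isCuFraisseSequence`), so every Fraïssé limit is a colimit of the
whole inclusion `elemIncl n`. This gives uniqueness.

The colimit is explicit. Rescale `E_m` to `{0, 1/m, …, 1, ∞}`. The connecting maps become
inclusions, with union the countable chain `D = (ℤ[1/n] ∩ [0, 1]) ∪ {∞}`. Its lower sets containing
zero form a `Cu`-semigroup whose principal members are compact, and compact-valued monotone additive
maps on `D` extend to it uniquely. It is therefore the colimit in `Cu` (`isColimitLimCocone`).

The four properties are read off from this model. Lower sets of a chain form a chain; every nonzero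
element of `D` has a multiple equal to the top element `∞`; `∞` is compact with `∞ + ∞ = ∞`; and
small fractions `1/n^k` have distinct multiples `m` and `2m`. -/

/-! ### The completion of a countable totally ordered monoid -/

set_option linter.unusedSectionVars false

/-- The order of the monoid `D` is positive. -/
class IsPositivelyOrdered (D : Type*) [Zero D] [LE D] : Prop where
  zero_le' : ∀ d : D, 0 ≤ d

/-- The lower sets of `D` that contain zero. -/
def LowerCompletion (D : Type*) [Zero D] [LE D] : Type _ := {I : LowerSet D // (0 : D) ∈ I}

namespace LowerCompletion

variable {D : Type*} [AddCommMonoid D] [LinearOrder D] [IsOrderedAddMonoid D]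
  [IsPositivelyOrdered D]

instance : PartialOrder (LowerCompletion D) :=
  inferInstanceAs (PartialOrder {I : LowerSet D // (0 : D) ∈ I})

instance : Membership D (LowerCompletion D) := ⟨fun x d => d ∈ x.1⟩

theorem ext_mem {x y : LowerCompletion D} (h : ∀ d, d ∈ x ↔ d ∈ y) : x = y :=
  Subtype.ext (SetLike.ext h)

theorem le_def {x y : LowerCompletion D} : x ≤ y ↔ ∀ d, d ∈ x → d ∈ y := Iff.rfl

theorem mem_of_le {x : LowerCompletion D} {d e : D} (h : d ≤ e) (he : e ∈ x) : d ∈ x :=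
  x.1.lower h he

theorem zero_mem (x : LowerCompletion D) : (0 : D) ∈ x := x.2

/-- The lower set generated by an element. -/
def principal (d : D) : LowerCompletion D := ⟨LowerSet.Iic d, IsPositivelyOrdered.zero_le' d⟩

theorem principal_le_iff {d : D} {x : LowerCompletion D} : principal d ≤ x ↔ d ∈ x :=
  ⟨fun h => h le_rfl, fun h _ he => mem_of_le he h⟩

theorem principal_le_principal {d e : D} : principal d ≤ principal e ↔ d ≤ e := principal_le_iff

theorem principal_mono : Monotone (principal : D → LowerCompletion D) :=
  fun _ _ h => principal_le_principal.2 h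

instance : Add (LowerCompletion D) where
  -- Sums of members need not form a lower set, hence `d ≤ a + b` instead of equality.
  add x y := ⟨⟨{d | ∃ a ∈ x, ∃ b ∈ y, d ≤ a + b},
      fun _ _ h ⟨a, ha, b, hb, hd⟩ => ⟨a, ha, b, hb, h.trans hd⟩⟩,
    0, x.zero_mem, 0, y.zero_mem, (add_zero 0).ge⟩

instance : Zero (LowerCompletion D) := ⟨principal 0⟩

theorem mem_zero {d : D} : d ∈ (0 : LowerCompletion D) ↔ d ≤ 0 := Iff.rfl

protected theorem add_comm' (x y : LowerCompletion D) : x + y = y + x :=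
  ext_mem fun _ => ⟨fun ⟨a, ha, b, hb, h⟩ => ⟨b, hb, a, ha, add_comm a b ▸ h⟩,
    fun ⟨a, ha, b, hb, h⟩ => ⟨b, hb, a, ha, add_comm a b ▸ h⟩⟩

protected theorem add_zero' (x : LowerCompletion D) : x + 0 = x := by
  refine ext_mem fun d => ⟨?_, fun h => ⟨d, h, 0, le_rfl, (add_zero d).ge⟩⟩
  rintro ⟨a, ha, b, hb, h⟩
  exact mem_of_le (h.trans ((add_le_add_right (mem_zero.1 hb) a).trans (add_zero a).le)) ha

protected theorem add_assoc' (x y z : LowerCompletion D) : x + y + z = x + (y + z) := by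
  refine ext_mem fun d => ⟨?_, ?_⟩
  · rintro ⟨e, ⟨a, ha, b, hb, he⟩, c, hc, h⟩
    exact ⟨a, ha, b + c, ⟨b, hb, c, hc, le_rfl⟩,
      h.trans ((add_le_add_left he c).trans (add_assoc a b c).le)⟩
  · rintro ⟨a, ha, e, ⟨b, hb, c, hc, he⟩, h⟩
    exact ⟨a + b, ⟨a, ha, b, hb, le_rfl⟩, c, hc,
      h.trans ((add_le_add_right he a).trans (add_assoc a b c).ge)⟩

instance : AddCommMonoid (LowerCompletion D) where
  add_assoc := LowerCompletion.add_assoc'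
  add_comm := LowerCompletion.add_comm'
  add_zero := LowerCompletion.add_zero'
  zero_add x := (LowerCompletion.add_comm' 0 x).trans (LowerCompletion.add_zero' x)
  nsmul := nsmulRec

instance : IsOrderedAddMonoid (LowerCompletion D) where
  add_le_add_left _ _ h _ _ := fun ⟨a, ha, b, hb, hd⟩ => ⟨a, h ha, b, hb, hd⟩

theorem principal_add (d e : D) : principal (d + e) = principal d + principal e :=
  ext_mem fun _ => ⟨fun h => ⟨d, le_rfl, e, le_rfl, h⟩,
    fun ⟨_, ha, _, hb, h⟩ => h.trans (add_le_add ha hb)⟩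

/-- The embedding of `D` into its completion. -/
def principalHom : D →+ LowerCompletion D where
  toFun := principal
  map_zero' := rfl
  map_add' := principal_add

/-- A union of lower sets containing zero is again one, so suprema of sequences are unions. -/
theorem isLUB_iff {z : ℕ → LowerCompletion D} {s : LowerCompletion D} :
    IsLUB (Set.range z) s ↔ ∀ d, d ∈ s ↔ ∃ k, d ∈ z k := by
  constructor
  · intro h d
    refine ⟨fun hd => ?_, fun ⟨k, hk⟩ => h.1 ⟨k, rfl⟩ hk⟩
    let u : LowerCompletion D := ⟨⟨{d | ∃ k, d ∈ z k},
      fun _ _ hle ⟨k, hk⟩ => ⟨k, mem_of_le hle hk⟩⟩, 0, (z 0).zero_mem⟩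
    have hu : s ≤ u := h.2 (by rintro _ ⟨k, rfl⟩ e he; exact ⟨k, he⟩)
    exact hu hd
  · intro h
    refine ⟨?_, fun b hb d hd => ?_⟩
    · rintro _ ⟨k, rfl⟩ e he
      exact (h e).2 ⟨k, he⟩
    · obtain ⟨k, hk⟩ := (h d).1 hd
      exact hb ⟨k, rfl⟩ hk

theorem le_total' (x y : LowerCompletion D) : x ≤ y ∨ y ≤ x := by
  by_contra! h
  simp only [le_def, not_forall] at h
  obtain ⟨⟨d, hdx, hdy⟩, e, hey, hex⟩ := h
  rcases le_total d e with h | h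
  · exact hdy (mem_of_le h hey)
  · exact hex (mem_of_le h hdx)

/-- A union that contains `d` already contains it at some finite stage. -/
theorem principal_below (d : D) : CuBelow (principal d) (principal d) := by
  intro z _ s hs hd
  obtain ⟨k, hk⟩ := (isLUB_iff.1 hs d).1 (principal_le_iff.1 hd)
  exact ⟨k, principal_le_iff.2 hk⟩

variable [Countable D]

theorem exists_cofinal (x : LowerCompletion D) :
    ∃ d : ℕ → D, Monotone d ∧ (∀ k, d k ∈ x) ∧ ∀ e ∈ x, ∃ k, e ≤ d k := by
  obtain ⟨f, hf⟩ := (Set.to_countable {d | d ∈ x}).exists_eq_range ⟨0, x.zero_mem⟩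
  have hfx : ∀ k, f k ∈ x := fun k => (Set.ext_iff.1 hf (f k)).2 ⟨k, rfl⟩
  -- In a chain the partial suprema of an enumeration are maxima, so they stay in `x`.
  refine ⟨partialSups f, (partialSups f).monotone, fun k => ?_, fun e he => ?_⟩
  · induction k with
    | zero => simpa using hfx 0
    | succ k ih =>
      rw [partialSups_add_one]
      rcases max_choice (partialSups f k) (f (k + 1)) with h | h
      · exact h.symm ▸ ih
      · exact h.symm ▸ hfx (k + 1)
  · obtain ⟨k, rfl⟩ := (Set.ext_iff.1 hf e).1 he
    exact ⟨k, le_partialSups f k⟩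

theorem isLUB_principal {x : LowerCompletion D} {d : ℕ → D} (hd : ∀ k, d k ∈ x)
    (hc : ∀ e ∈ x, ∃ k, e ≤ d k) : IsLUB (Set.range fun k => principal (d k)) x :=
  isLUB_iff.2 fun e => ⟨hc e, fun ⟨k, hk⟩ => mem_of_le hk (hd k)⟩

/-- Countability makes `y` the supremum of a sequence of principal lower sets, so `x ≪ y` places `x`
under one of them; conversely those are compact. -/
theorem below_iff {x y : LowerCompletion D} :
    CuBelow x y ↔ ∃ d ∈ y, x ≤ principal d := by
  constructor
  · intro h
    obtain ⟨d, hm, hd, hc⟩ := exists_cofinal y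
    obtain ⟨k, hk⟩ := h _ (principal_mono.comp hm) y (isLUB_principal hd hc) le_rfl
    exact ⟨d k, hd k, hk⟩
  · rintro ⟨d, hd, hx⟩ z hz s hs hy
    obtain ⟨k, hk⟩ := principal_below d z hz s hs ((principal_le_iff.2 hd).trans hy)
    exact ⟨k, hx.trans hk⟩

instance : CuSemigroup (LowerCompletion D) where
  cu_zero_le _ := principal_le_iff.2 (zero_mem _)
  exists_isLUB z _ :=
    ⟨⟨⟨{d | ∃ k, d ∈ z k}, fun _ _ hle ⟨k, hk⟩ => ⟨k, mem_of_le hle hk⟩⟩, 0, (z 0).zero_mem⟩,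
      isLUB_iff.2 fun _ => Iff.rfl⟩
  exists_below_seq x := by
    obtain ⟨d, hm, hd, hc⟩ := exists_cofinal x
    exact ⟨fun k => principal (d k),
      fun k => below_iff.2 ⟨d k, hm (Nat.le_succ k), le_rfl⟩, isLUB_principal hd hc⟩
  add_below_add x' x y' y hx hy := by
    obtain ⟨d, hd, hx⟩ := below_iff.1 hx
    obtain ⟨e, he, hy⟩ := below_iff.1 hy
    exact below_iff.2 ⟨d + e, ⟨d, hd, e, he, le_rfl⟩, principal_add d e ▸ add_le_add hx hy⟩
  isLUB_add z w hz hw s t hs ht := by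
    rw [isLUB_iff] at *
    intro d
    constructor
    · rintro ⟨a, ha, b, hb, h⟩
      obtain ⟨k, hk⟩ := (hs a).1 ha
      obtain ⟨l, hl⟩ := (ht b).1 hb
      exact ⟨max k l, a, hz (le_max_left k l) hk, b, hw (le_max_right k l) hl, h⟩
    · rintro ⟨k, a, ha, b, hb, h⟩
      exact ⟨a, (hs a).2 ⟨k, ha⟩, b, (ht b).2 ⟨k, hb⟩, h⟩

/-! ### Extending maps from `D` to its completion -/

section Extension

variable {T : Type*} [CuSemigroup T]

/-- Axioms (O1) and (O4) speak of sequences only; this trades the supremum over all of `x` for one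
along a cofinal sequence. -/
theorem isLUB_image_of_cofinal {g : D → T} (hg : Monotone g) {x : LowerCompletion D} {d : ℕ → D}
    (hd : ∀ k, d k ∈ x) (hc : ∀ e ∈ x, ∃ k, e ≤ d k) {s : T} :
    IsLUB (g '' {e | e ∈ x}) s ↔ IsLUB (Set.range fun k => g (d k)) s := by
  have : upperBounds (g '' {e | e ∈ x}) = upperBounds (Set.range fun k => g (d k)) := by
    ext b
    constructor
    · rintro h _ ⟨k, rfl⟩
      exact h ⟨d k, hd k, rfl⟩
    · rintro h _ ⟨e, he, rfl⟩
      obtain ⟨k, hk⟩ := hc e he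
      exact (hg hk).trans (h ⟨k, rfl⟩)
  rw [IsLUB, IsLUB, this]

theorem exists_isLUB_image {g : D → T} (hg : Monotone g) (x : LowerCompletion D) : ∃ s, IsLUB (g '' {e | e ∈ x}) s := by
  obtain ⟨d, hm, hd, hc⟩ := exists_cofinal x
  obtain ⟨s, hs⟩ := CuSemigroup.exists_isLUB (fun k => g (d k)) (hg.comp hm)
  exact ⟨s, (isLUB_image_of_cofinal hg hd hc).2 hs⟩

/-- The extension of a monotone map on `D` to the completion, preserving suprema. -/
noncomputable def extendFun {g : D → T} (hg : Monotone g) (x : LowerCompletion D) : T :=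
  (exists_isLUB_image hg x).choose

theorem isLUB_extendFun {g : D → T} (hg : Monotone g) (x : LowerCompletion D) :
    IsLUB (g '' {e | e ∈ x}) (extendFun hg x) :=
  (exists_isLUB_image hg x).choose_spec

theorem extendFun_mono {g : D → T} (hg : Monotone g) : Monotone (extendFun hg) :=
  fun x y h => (isLUB_extendFun hg x).mono (isLUB_extendFun hg y) (Set.image_mono fun _ he => h he)

theorem extendFun_principal {g : D → T} (hg : Monotone g) (d : D) :
    extendFun hg (principal d) = g d := by
  refine (isLUB_extendFun hg _).unique ⟨?_, fun b hb => hb ⟨d, le_rfl, rfl⟩⟩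
  rintro _ ⟨e, he, rfl⟩
  exact hg he

/-- If `d` and `e` are cofinal in `x` and `y`, then `d k + e k` is cofinal in `x + y`, and (O4) in
`T` applies. -/
theorem extendFun_add {g : D →+ T} (hg : Monotone g) (x y : LowerCompletion D) :
    extendFun hg (x + y) = extendFun hg x + extendFun hg y := by
  obtain ⟨d, hdm, hd, hdc⟩ := exists_cofinal x
  obtain ⟨e, hem, he, hec⟩ := exists_cofinal y
  have h := CuSemigroup.isLUB_add _ _ (hg.comp hdm) (hg.comp hem) _ _
    ((isLUB_image_of_cofinal hg hd hdc).1 (isLUB_extendFun hg x))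
    ((isLUB_image_of_cofinal hg he hec).1 (isLUB_extendFun hg y))
  have hde : ∀ k, d k + e k ∈ x + y := fun k => ⟨d k, hd k, e k, he k, le_rfl⟩
  refine (isLUB_extendFun hg (x + y)).unique ((isLUB_image_of_cofinal hg hde ?_).2 ?_)
  · rintro c ⟨a, ha, b, hb, h⟩
    obtain ⟨k, hk⟩ := hdc a ha
    obtain ⟨l, hl⟩ := hec b hb
    exact ⟨max k l, h.trans (add_le_add (hk.trans (hdm (le_max_left k l)))
      (hl.trans (hem (le_max_right k l))))⟩
  · simpa only [map_add, Function.comp_apply] using h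

/-- A monotone additive map on `D` with compact values extends to a `Cu`-morphism. -/
noncomputable def extend (g : D →+ T) (hg : Monotone g) (hb : ∀ d, CuBelow (g d) (g d)) :
    CuHom (LowerCompletion D) T where
  toFun := extendFun hg
  map_zero' := (extendFun_principal hg 0).trans (map_zero g)
  map_add' := extendFun_add hg
  monotone' := extendFun_mono hg
  -- The relation `x ≪ y` factors through some `d ∈ y`, and `g d` is compact.
  map_below' x y h z hz s hs hy := by
    obtain ⟨d, hd, hx⟩ := below_iff.1 h
    obtain ⟨k, hk⟩ := hb d z hz s hs (((isLUB_extendFun hg y).1 ⟨d, hd, rfl⟩).trans hy)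
    exact ⟨k, (extendFun_mono hg hx).trans ((extendFun_principal hg d).trans_le hk)⟩
  map_isLUB' z hz s hs := by
    constructor
    · rintro _ ⟨k, rfl⟩
      exact extendFun_mono hg (hs.1 ⟨k, rfl⟩)
    · intro b hb
      refine (isLUB_extendFun hg s).2 ?_
      rintro _ ⟨d, hd, rfl⟩
      obtain ⟨k, hk⟩ := (isLUB_iff.1 hs d).1 hd
      exact ((isLUB_extendFun hg (z k)).1 ⟨d, hk, rfl⟩).trans (hb ⟨k, rfl⟩)

/-- `Cu`-morphisms out of the completion are determined on `D`. -/
theorem hom_ext {f g : CuHom (LowerCompletion D) T} (h : ∀ d, f (principal d) = g (principal d)) :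
    f = g := by
  refine DFunLike.ext _ _ fun x => ?_
  obtain ⟨d, hm, hd, hc⟩ := exists_cofinal x
  have hf := f.map_isLUB' _ (principal_mono.comp hm) x (isLUB_principal hd hc)
  have hg := g.map_isLUB' _ (principal_mono.comp hm) x (isLUB_principal hd hc)
  exact hf.unique ((congrArg (fun u => IsLUB (Set.range u) (g x)) (funext fun k => h (d k))).mpr hg)

end Extension

end LowerCompletion

/-! ### Morphisms out of the elementary semigroups -/

namespace ElemSg

variable {m l : ℕ}

theorem val_one : (1 : ElemSg m).val = 1 := rfl

theorem val_nsmul (j : ℕ) (x : ElemSg m) : (j • x).val = min (j * x.val) (m + 1) := by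
  induction j with
  | zero => rw [zero_smul, val_zero, zero_mul, Nat.zero_min]
  | succ j ih => rw [succ_nsmul, val_add, ih, Nat.succ_mul]; omega

/-- The element `∞` is included, as `(m + 1) • 1`; hence a morphism is determined by the image of
`1`. -/
theorem eq_nsmul_one (x : ElemSg m) : x = x.val • (1 : ElemSg m) :=
  val_injective (by have := x.le'; rw [val_nsmul, val_one]; omega)

/-- A monotone additive map with compact values on `E_m` is a `Cu`-morphism. -/
def toCuHom {T : Type*} [CuSemigroup T] (g : ElemSg m →+ T) (hg : Monotone g)
    (hb : ∀ x, CuBelow (g x) (g x)) : CuHom (ElemSg m) T where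
  toAddMonoidHom := g
  monotone' := hg
  map_below' x y h z hz s hs hy := by
    obtain ⟨k, hk⟩ := hb y z hz s hs hy
    exact ⟨k, (hg ((below_iff x y).1 h)).trans hk⟩
  map_isLUB' z hz s hs := by
    obtain ⟨k, rfl⟩ := exists_eq_of_isLUB z s hs
    constructor
    · rintro _ ⟨i, rfl⟩
      exact hg (hs.1 ⟨i, rfl⟩)
    · exact fun b hb => hb ⟨k, rfl⟩

/-- If `b < a` then `b ≤ m`, so `b * c ≤ l` is not truncated and stays strictly below the image of
`a`. -/
theorem scale_le_iff {c : ℕ} (h : l = m * c) (hc : 0 < c) {a b : ℕ} (ha : a ≤ m + 1) :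
    min (a * c) (l + 1) ≤ min (b * c) (l + 1) ↔ a ≤ b := by
  constructor
  · contrapose!
    intro hab
    have h1 : (b + 1) * c ≤ a * c := Nat.mul_le_mul_right c hab
    have h2 : b * c ≤ m * c := Nat.mul_le_mul_right c (by omega)
    rw [add_mul] at h1
    omega
  · intro hab
    have h1 : a * c ≤ b * c := Nat.mul_le_mul_right c hab
    omega

/-- Multiplication by `c` as a morphism from `E_m` to `E_{m c}`. -/
def scale {c : ℕ} (h : l = m * c) (hc : 0 < c) : CuHom (ElemSg m) (ElemSg l) :=
  toCuHom
    { toFun := fun x => ⟨min (x.val * c) (l + 1), min_le_right _ _⟩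
      map_zero' := val_injective (by simp [val_zero])
      map_add' := fun x y => val_injective (by
        simp only [val_add]
        rcases le_total (x.val + y.val) (m + 1) with hxy | hxy
        · rw [min_eq_left hxy, add_mul]
          omega
        -- Here `x + y = ∞`, and `(m + 1) * c ≥ l + 1` makes both sides `∞`.
        · have h1 : (m + 1) * c ≤ (x.val + y.val) * c := Nat.mul_le_mul_right c hxy
          rw [min_eq_right hxy]
          rw [add_mul, add_mul] at h1
          rw [add_mul]
          omega) }
    (fun x _ hxy => (scale_le_iff h hc x.le').2 hxy)
    fun _ => (below_iff _ _).2 le_rfl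

theorem isElemMor_scale {n r : ℕ} (h : l = m * n ^ r) (hn : 0 < n ^ r) :
    IsElemMor n (scale h hn) :=
  ⟨fun x _ => scale_le_iff h hn x.le', r, val_injective (by
    rw [val_nsmul, val_one, mul_one]
    exact congrArg (fun a => min a (l + 1)) (one_mul _))⟩

theorem exists_scale_of_isElemMor {n k s : ℕ} (hn : 2 ≤ n) (hm : m = n ^ k) (hl : l = n ^ s)
    {f : CuHom (ElemSg m) (ElemSg l)} (hf : IsElemMor n f) :
    ∃ c, 0 < c ∧ l = m * c ∧ ∀ x, (f x).val = min (x.val * c) (l + 1) := by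
  obtain ⟨hord, r, hr⟩ := hf
  have hval : ∀ x, (f x).val = min (x.val * n ^ r) (l + 1) := by
    intro x
    have : f x = x.val • f 1 := by
      conv_lhs => rw [eq_nsmul_one x]
      exact map_nsmul f.toAddMonoidHom _ _
    rw [this, hr, ← mul_smul, val_nsmul, val_one, mul_one]
  refine ⟨n ^ r, by positivity, ?_, hval⟩
  -- `a` is the largest finite element and `t` is `∞`. Strictness `f a < f t` gives `m * n ^ r ≤ l`;
  -- absorption `t = t + 1` gives `l < (m + 1) * n ^ r`.
  let a : ElemSg m := ⟨m, m.le_succ⟩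
  let t : ElemSg m := ⟨m + 1, le_rfl⟩
  have hlt : ¬ f t ≤ f a := fun h => Nat.not_succ_le_self m ((hord t a).1 h)
  rw [le_iff, hval, hval] at hlt
  change ¬ min ((m + 1) * n ^ r) (l + 1) ≤ min (m * n ^ r) (l + 1) at hlt
  have htt : f t = f t + f 1 := by
    have : t = t + 1 := val_injective (by rw [val_add, val_one]; simp [t])
    conv_lhs => rw [this]
    exact map_add f.toAddMonoidHom _ _
  have htv := congrArg val htt
  rw [val_add, hval, hval] at htv
  change min ((m + 1) * n ^ r) (l + 1) =
    min (min ((m + 1) * n ^ r) (l + 1) + min (1 * n ^ r) (l + 1)) (l + 1) at htv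
  have hpos : 0 < n ^ r := by positivity
  have h1 : m * n ^ r ≤ l := by omega
  have h2 : l < m * n ^ r + n ^ r := by rw [add_mul] at htv; omega
  subst hm hl
  rw [← pow_add] at h1 h2 ⊢
  have h3 : k + r ≤ s := (Nat.pow_le_pow_iff_right hn).1 h1
  -- `n ^ s < n ^ (k + r) + n ^ r ≤ 2 * n ^ (k + r) ≤ n ^ (k + r + 1)`.
  have h4 : s < k + r + 1 := by
    refine (Nat.pow_lt_pow_iff_right hn).1 (h2.trans_le ?_)
    have h5 : n ^ r ≤ n ^ (k + r) := Nat.pow_le_pow_right (by omega) (by omega)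
    have h6 : n ^ (k + r) * 2 ≤ n ^ (k + r) * n := Nat.mul_le_mul_left _ hn
    rw [pow_succ]
    omega
  rw [show s = k + r by omega]

end ElemSg

/-! ### The category `𝔢_n` is thin and directed -/

namespace ElemCat

variable {n : ℕ}

theorem size_pos (hn : 2 ≤ n) (A : ElemCat n) : 0 < A.size := by
  obtain ⟨k, hk⟩ := A.isPow
  rw [hk]
  positivity

theorem exists_scale (hn : 2 ≤ n) {A B : ElemCat n} (f : A ⟶ B) :
    ∃ c, 0 < c ∧ B.size = A.size * c ∧ ∀ x, (f.1 x).val = min (x.val * c) (B.size + 1) :=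
  ElemSg.exists_scale_of_isElemMor hn A.isPow.choose_spec B.isPow.choose_spec f.2

/-- The scaling factor is the quotient of the two sizes. -/
theorem hom_unique (hn : 2 ≤ n) {A B : ElemCat n} (f g : A ⟶ B) : f = g := by
  obtain ⟨c, -, hBc, hc⟩ := exists_scale hn f
  obtain ⟨d, -, hBd, hd⟩ := exists_scale hn g
  obtain rfl : c = d := Nat.eq_of_mul_eq_mul_left (size_pos hn A) (hBc.symm.trans hBd)
  exact Subtype.ext (DFunLike.ext _ _ fun x => ElemSg.val_injective ((hc x).trans (hd x).symm))

theorem size_le (hn : 2 ≤ n) {A B : ElemCat n} (f : A ⟶ B) : A.size ≤ B.size := by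
  obtain ⟨c, hc, hBc, -⟩ := exists_scale hn f
  exact hBc ▸ Nat.le_mul_of_pos_right _ hc

theorem nonempty_hom (hn : 2 ≤ n) {A B : ElemCat n} (h : A.size ≤ B.size) :
    Nonempty (A ⟶ B) := by
  obtain ⟨k, hk⟩ := A.isPow
  obtain ⟨s, hs⟩ := B.isPow
  rw [hk, hs, Nat.pow_le_pow_iff_right hn] at h
  have hB : B.size = A.size * n ^ (s - k) := by
    rw [hk, hs, ← pow_add, Nat.add_sub_cancel' h]
  exact ⟨⟨ElemSg.scale hB (by positivity), ElemSg.isElemMor_scale hB _⟩⟩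

theorem exists_common (hn : 2 ≤ n) (A B : ElemCat n) :
    ∃ D : ElemCat n, Nonempty (A ⟶ D) ∧ Nonempty (B ⟶ D) := by
  rcases le_total A.size B.size with h | h
  · exact ⟨B, nonempty_hom hn h, nonempty_hom hn le_rfl⟩
  · exact ⟨A, nonempty_hom hn le_rfl, nonempty_hom hn h⟩

/-- The object `E_{n^k}`. -/
def ofExp (n k : ℕ) : ElemCat n := ⟨n ^ k, k, rfl⟩

theorem isFiltered (hn : 2 ≤ n) : IsFiltered (ElemCat n) where
  cocone_objs A B := by
    obtain ⟨D, ⟨f⟩, ⟨g⟩⟩ := exists_common hn A B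
    exact ⟨D, f, g, trivial⟩
  cocone_maps _ B _ _ := ⟨B, 𝟙 B, hom_unique hn _ _⟩
  nonempty := ⟨ofExp n 0⟩

theorem countable (n : ℕ) : Countable (ElemCat n) :=
  Function.Injective.countable (f := ElemCat.size) (by
    rintro ⟨a, _⟩ ⟨b, _⟩ h
    cases h
    rfl)

theorem compareOn_of_hom (hn : 2 ≤ n) {A B : ElemCat n} (F : Finset ((elemIncl n).obj A))
    (f g : A ⟶ B) : CompareOn F ((elemIncl n).map f) ((elemIncl n).map g) := by
  obtain rfl := hom_unique hn f g
  intro x' _ x _ h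
  have := ((elemIncl n).map f).monotone' ((ElemSg.below_iff x' x).1 h)
  exact ⟨this, this⟩

theorem countablyBased (A : ElemCat n) : CountablyBased ((elemIncl n).obj A) := by
  have : Countable (ElemSg A.size) := ElemSg.val_injective.countable
  refine ⟨Set.univ, ?_, fun x => ⟨fun _ => x, monotone_const, fun _ => trivial, by simp⟩⟩
  exact Set.countable_univ (α := ElemSg A.size)

theorem isCuFraisseCategory (hn : 2 ≤ n) : IsCuFraisseCategory (elemIncl n) := by
  -- The category is small enough to serve as its own dominating subcategory.
  refine ⟨exists_common hn, ?_, ⊤, ⊤, fun _ _ _ _ => ⟨trivial, trivial⟩, fun _ _ => trivial,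
    fun _ _ _ _ _ _ _ => trivial, fun A _ => countablyBased A, ?_,
    fun A => ⟨A, trivial, ⟨𝟙 A⟩⟩,
    fun S A σ _ F => ⟨A, 𝟙 A, σ, trivial, trivial, compareOn_of_hom hn F _ _⟩⟩
  · intro A B₁ B₂ α₁ α₂ F
    obtain ⟨D, ⟨f⟩, ⟨g⟩⟩ := exists_common hn B₁ B₂
    exact ⟨D, f, g, compareOn_of_hom hn F _ _⟩
  · have := countable n
    -- By thinness an arrow is determined by its endpoints.
    have hinj : Function.Injective fun f : Arrow (ElemCat n) => (f.left, f.right) := by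
      rintro ⟨A, B, f⟩ ⟨A', B', g⟩ h
      obtain ⟨rfl, rfl⟩ := Prod.mk.inj h
      exact congrArg (Arrow.mk) (hom_unique hn f g)
    have := hinj.countable
    exact Set.to_countable _

/-- Any `A` maps to some `D` that also receives `S.obj 0`, and the Fraïssé property sends `D` back
into the sequence. Only existence of `β` matters, so the empty finite set suffices. -/
theorem final_of_isCuFraisseSequence (hn : 2 ≤ n) {S : ℕ ⥤ ElemCat n}
    (hS : IsCuFraisseSequence (elemIncl n) S) : S.Final := by
  have := isFiltered hn
  refine Functor.final_of_exists_of_isFiltered S (fun A => ?_) fun _ _ => ⟨_, 𝟙 _, hom_unique hn _ _⟩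
  obtain ⟨D, ⟨f⟩, ⟨g⟩⟩ := exists_common hn A (S.obj 0)
  obtain ⟨j, -, β, -⟩ := hS.2 0 ∅ D g
  exact ⟨j, ⟨f ≫ β⟩⟩

theorem exists_isCuFraisseSequence (hn : 2 ≤ n) :
    ∃ S : ℕ ⥤ ElemCat n, IsCuFraisseSequence (elemIncl n) S := by
  have hle : ∀ {i j : ℕ}, i ≤ j → (ofExp n i).size ≤ (ofExp n j).size :=
    fun h => Nat.pow_le_pow_right (by omega) h
  let S : ℕ ⥤ ElemCat n :=
    { obj := ofExp n
      map := fun f => (nonempty_hom hn (hle (leOfHom f))).some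
      map_id := fun _ => hom_unique hn _ _
      map_comp := fun _ _ => hom_unique hn _ _ }
  refine ⟨S, fun i => countablyBased _, fun i F A α => ?_⟩
  obtain ⟨k, hk⟩ := A.isPow
  have hik : i ≤ k := (Nat.pow_le_pow_iff_right hn).1 (hk ▸ size_le hn α)
  obtain ⟨β⟩ := nonempty_hom hn (A := A) (B := S.obj k) hk.le
  exact ⟨k, hik, β, compareOn_of_hom hn F _ _⟩

end ElemCat

/-! ### The algebraic limit of the elementary semigroups -/

/-- The truncated monoid `(ℤ[1/n] ∩ [0, 1]) ∪ {∞}`, the element `∞` being encoded as `2`. -/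
@[ext]
structure ElemLim (n : ℕ) where
  val : ℚ
  nonneg : 0 ≤ val
  le_one_or : val ≤ 1 ∨ val = 2
  exists_num : ∃ k a : ℕ, val * (n : ℚ) ^ k = a

namespace ElemLim

variable {n : ℕ}

theorem val_injective : Function.Injective (val : ElemLim n → ℚ) := fun _ _ h => ElemLim.ext h

noncomputable instance : LinearOrder (ElemLim n) := LinearOrder.lift' val val_injective

theorem le_iff {x y : ElemLim n} : x ≤ y ↔ x.val ≤ y.val := Iff.rfl

instance : Countable (ElemLim n) := val_injective.countable

/-- The element `∞`. -/
def infty (n : ℕ) : ElemLim n := ⟨2, by norm_num, Or.inr rfl, 0, 2, by norm_num⟩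

instance : Zero (ElemLim n) := ⟨⟨0, le_rfl, Or.inl zero_le_one, 0, 0, by norm_num⟩⟩

instance : Add (ElemLim n) where
  add x y :=
    { val := if x.val + y.val ≤ 1 then x.val + y.val else 2
      nonneg := by
        have := x.nonneg
        have := y.nonneg
        split_ifs <;> linarith
      le_one_or := by
        split_ifs with h
        · exact Or.inl h
        · exact Or.inr rfl
      exists_num := by
        obtain ⟨k, a, ha⟩ := x.exists_num
        obtain ⟨l, b, hb⟩ := y.exists_num
        split_ifs with h
        · refine ⟨k + l, a * n ^ l + b * n ^ k, ?_⟩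
          push_cast
          rw [← ha, ← hb]
          ring
        · exact ⟨0, 2, by norm_num⟩ }

theorem val_zero : (0 : ElemLim n).val = 0 := rfl

theorem val_add (x y : ElemLim n) :
    (x + y).val = if x.val + y.val ≤ 1 then x.val + y.val else 2 := rfl

theorem val_le_two (x : ElemLim n) : x.val ≤ 2 := by
  rcases x.le_one_or with h | h <;> linarith

instance : AddCommMonoid (ElemLim n) where
  add_assoc x y z := val_injective (by
    have := x.nonneg
    have := y.nonneg
    have := z.nonneg
    simp only [val_add]
    -- Any sum involving `∞`, encoded as `2`, exceeds `1` and collapses to `2` again.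
    split_ifs <;> linarith)
  zero_add x := val_injective (by
    simp only [val_add, val_zero, zero_add]
    split_ifs with h
    · rfl
    · exact (x.le_one_or.resolve_left h).symm)
  add_zero x := val_injective (by
    simp only [val_add, val_zero, add_zero]
    split_ifs with h
    · rfl
    · exact (x.le_one_or.resolve_left h).symm)
  add_comm x y := val_injective (by simp only [val_add, add_comm])
  nsmul := nsmulRec

instance : IsOrderedAddMonoid (ElemLim n) where
  add_le_add_left x y h z := by
    rw [le_iff] at h ⊢
    simp only [val_add]
    split_ifs <;> linarith

instance : IsPositivelyOrdered (ElemLim n) := ⟨fun x => x.nonneg⟩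

theorem le_infty (x : ElemLim n) : x ≤ infty n := x.val_le_two

theorem infty_add_infty : infty n + infty n = infty n :=
  val_injective (by rw [val_add]; norm_num [infty])

/-- Archimedean property: multiples are the true ones until they exceed `1`, where only `∞` is left.
-/
theorem exists_nsmul_eq_infty {x : ElemLim n} (hx : x ≠ 0) : ∃ j : ℕ, j • x = infty n := by
  have hpos : 0 < x.val := x.nonneg.lt_of_ne fun h => hx (val_injective h.symm)
  have key : ∀ j : ℕ, (j • x).val = 2 ∨ (j • x).val = j * x.val := by
    intro j
    induction j with
    | zero => right; simp [val_zero]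
    | succ j ih =>
      rw [succ_nsmul, val_add]
      push_cast
      split_ifs with h
      · right
        rcases ih with ih | ih
        · linarith
        · rw [ih, add_mul, one_mul]
      · exact Or.inl rfl
  obtain ⟨j, hj⟩ := exists_nat_gt (1 / x.val)
  rw [div_lt_iff₀ hpos] at hj
  refine ⟨j, val_injective ?_⟩
  rcases key j with h | h
  · exact h
  · exact (j • x).le_one_or.resolve_left (by linarith)

end ElemLim

/-! ### The limit as a colimit of `𝔢_n` -/

namespace ElemCat

variable {n : ℕ}

/-- The embedding of `E_{n^k}` into the algebraic limit. -/
def toLim (hn : 2 ≤ n) (A : ElemCat n) : ElemSg A.size →+ ElemLim n where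
  toFun x :=
    { val := if x.val ≤ A.size then (x.val : ℚ) / A.size else 2
      nonneg := by split_ifs <;> positivity
      le_one_or := by
        have : (0 : ℚ) < A.size := by exact_mod_cast size_pos hn A
        split_ifs with h
        · left
          rw [div_le_one this]
          exact_mod_cast h
        · exact Or.inr rfl
      exists_num := by
        have : (0 : ℚ) < A.size := by exact_mod_cast size_pos hn A
        obtain ⟨k, hk⟩ := A.isPow
        split_ifs with h
        · refine ⟨k, x.val, ?_⟩
          rw [← Nat.cast_pow, ← hk]
          field_simp
        · exact ⟨0, 2, by norm_num⟩ }
  map_zero' := ElemLim.val_injective (by simp [ElemSg.val_zero, ElemLim.val_zero])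
  map_add' x y := ElemLim.val_injective (by
    have hA : (0 : ℚ) < A.size := by exact_mod_cast size_pos hn A
    have h1 : (0 : ℚ) ≤ (x.val : ℚ) / A.size := by positivity
    have h2 : (0 : ℚ) ≤ (y.val : ℚ) / A.size := by positivity
    simp only [ElemSg.val_add, ElemLim.val_add]
    by_cases hx : x.val ≤ A.size
    · by_cases hy : y.val ≤ A.size
      · have hiff : ((x.val + y.val : ℕ) : ℚ) / A.size ≤ 1 ↔ x.val + y.val ≤ A.size := by
          rw [div_le_one hA, Nat.cast_le]
        rw [if_pos hx, if_pos hy, ← add_div, ← Nat.cast_add]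
        by_cases hxy : x.val + y.val ≤ A.size
        · rw [if_pos (hiff.2 hxy), if_pos (by omega), min_eq_left (by omega)]
        · rw [if_neg (mt hiff.1 hxy), if_neg (by omega)]
      · rw [if_neg (by omega), if_neg hy, if_neg (by split_ifs; linarith)]
    · rw [if_neg (by omega), if_neg hx, if_neg (by split_ifs <;> linarith)])

theorem toLim_val (hn : 2 ≤ n) (A : ElemCat n) (x : ElemSg A.size) :
    (toLim hn A x).val = if x.val ≤ A.size then (x.val : ℚ) / A.size else 2 := rfl

theorem toLim_le_iff (hn : 2 ≤ n) (A : ElemCat n) {x y : ElemSg A.size} :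
    toLim hn A x ≤ toLim hn A y ↔ x ≤ y := by
  have hA : (0 : ℚ) < A.size := by exact_mod_cast size_pos hn A
  have hdiv : ∀ z : ElemSg A.size, z.val ≤ A.size → (z.val : ℚ) / A.size ≤ 1 := fun z hz => by
    rw [div_le_one hA]
    exact_mod_cast hz
  have := x.le'
  have := y.le'
  rw [ElemLim.le_iff, ElemSg.le_iff, toLim_val, toLim_val]
  split_ifs with hx hy hy
  · rw [div_le_div_iff_of_pos_right hA, Nat.cast_le]
  · exact iff_of_true ((hdiv x hx).trans (by norm_num)) (by omega)
  · exact iff_of_false (fun h => by linarith [hdiv y hy]) (by omega)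
  · exact iff_of_true le_rfl (by omega)

theorem toLim_map (hn : 2 ≤ n) {A B : ElemCat n} (f : A ⟶ B) (x : ElemSg A.size) :
    toLim hn B (f.1 x) = toLim hn A x := by
  obtain ⟨c, hc, hB, hf⟩ := exists_scale hn f
  have hA : (0 : ℚ) < A.size := by exact_mod_cast size_pos hn A
  have hc' : (0 : ℚ) < c := by exact_mod_cast hc
  refine ElemLim.val_injective ?_
  rw [toLim_val, toLim_val, hf]
  by_cases hx : x.val ≤ A.size
  · have h1 : x.val * c ≤ B.size := hB ▸ Nat.mul_le_mul_right c hx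
    rw [if_pos hx, min_eq_left (by omega), if_pos h1, hB]
    push_cast
    field_simp
  · have h1 : (A.size + 1) * c ≤ x.val * c := Nat.mul_le_mul_right c (by omega)
    rw [add_mul, ← hB] at h1
    rw [if_neg hx, if_neg (by omega)]

/-- A fraction `a / n ^ k` lives in `E_{n^k}`, and `∞` already in `E_1`. -/
theorem exists_toLim_eq (hn : 2 ≤ n) (d : ElemLim n) :
    ∃ (A : ElemCat n) (x : ElemSg A.size), toLim hn A x = d := by
  rcases d.le_one_or with h | h
  · obtain ⟨k, a, ha⟩ := d.exists_num
    have hpos : (0 : ℚ) < (n : ℚ) ^ k := by positivity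
    have hle : a ≤ n ^ k := by
      have : (a : ℚ) ≤ (n : ℚ) ^ k := ha ▸ mul_le_of_le_one_left hpos.le h
      exact_mod_cast this
    refine ⟨ofExp n k, ⟨a, Nat.le_succ_of_le hle⟩, ElemLim.val_injective ?_⟩
    refine (if_pos hle).trans ?_
    change (a : ℚ) / ((n ^ k : ℕ) : ℚ) = d.val
    rw [← ha, Nat.cast_pow, mul_div_cancel_right₀ _ hpos.ne']
  · refine ⟨ofExp n 0, ⟨_, le_rfl⟩, ElemLim.val_injective ?_⟩
    rw [toLim_val, if_neg (Nat.not_succ_le_self _), h]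

/-- The completion of the algebraic limit, which is the limit `𝓔_n` in `Cu`. -/
noncomputable abbrev limObj (n : ℕ) : CuSg := ⟨LowerCompletion (ElemLim n)⟩

/-- The canonical morphism from `E_{n^k}` to the limit. -/
noncomputable def toLimObj (hn : 2 ≤ n) (A : ElemCat n) :
    CuHom (ElemSg A.size) (LowerCompletion (ElemLim n)) :=
  ElemSg.toCuHom (LowerCompletion.principalHom.comp (toLim hn A))
    (fun _ _ h => LowerCompletion.principal_mono ((toLim_le_iff hn A).2 h))
    fun _ => LowerCompletion.principal_below _

theorem toLimObj_apply (hn : 2 ≤ n) (A : ElemCat n) (x : ElemSg A.size) :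
    toLimObj hn A x = LowerCompletion.principal (toLim hn A x) := rfl

/-- The canonical cocone over the whole category `𝔢_n`. -/
noncomputable def limCocone (hn : 2 ≤ n) : Cocone (elemIncl n) where
  pt := limObj n
  ι :=
    { app := fun A => toLimObj hn A
      naturality := fun _ _ f => DFunLike.ext (F := CuHom _ _) _ _ fun x =>
        congrArg LowerCompletion.principal (toLim_map hn f x) }

section Descent

variable (s : Cocone (elemIncl n))

/-- The morphisms of a cocone. -/
def leg (A : ElemCat n) : CuHom (ElemSg A.size) s.pt := s.ι.app A

theorem leg_map {A B : ElemCat n} (f : A ⟶ B) (x : ElemSg A.size) :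
    leg s B (f.1 x) = leg s A x :=
  DFunLike.congr_fun (F := CuHom (ElemSg A.size) s.pt) (s.w f) x

/-- The comparison is made in a common target, where `toLim` is an order-embedding. This yields both
well-definedness and monotonicity of `descFun`. -/
theorem leg_le (hn : 2 ≤ n) {A B : ElemCat n} {x : ElemSg A.size} {y : ElemSg B.size}
    (h : toLim hn A x ≤ toLim hn B y) : leg s A x ≤ leg s B y := by
  obtain ⟨D, ⟨f⟩, ⟨g⟩⟩ := exists_common hn A B
  rw [← toLim_map hn f, ← toLim_map hn g, toLim_le_iff] at h
  rw [← leg_map s f, ← leg_map s g]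
  exact (leg s D).monotone' h

/-- The map induced by a cocone on the algebraic limit. -/
noncomputable def descFun (hn : 2 ≤ n) (d : ElemLim n) : s.pt :=
  leg s _ (exists_toLim_eq hn d).choose_spec.choose

theorem descFun_toLim (hn : 2 ≤ n) (A : ElemCat n) (x : ElemSg A.size) :
    descFun s hn (toLim hn A x) = leg s A x :=
  le_antisymm (leg_le s hn (exists_toLim_eq hn _).choose_spec.choose_spec.le)
    (leg_le s hn (exists_toLim_eq hn _).choose_spec.choose_spec.ge)

theorem descFun_mono (hn : 2 ≤ n) : Monotone (descFun s hn) := by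
  intro d e h
  obtain ⟨A, x, rfl⟩ := exists_toLim_eq hn d
  obtain ⟨B, y, rfl⟩ := exists_toLim_eq hn e
  rw [descFun_toLim, descFun_toLim]
  exact leg_le s hn h

/-- Values come from some `E_m`, in which every element is compact, and legs preserve `≪`. -/
theorem descFun_below (hn : 2 ≤ n) (d : ElemLim n) :
    CuBelow (descFun s hn d) (descFun s hn d) :=
  (leg s _).map_below' _ _ ((ElemSg.below_iff _ _).2 le_rfl)

/-- The additive map induced by a cocone on the algebraic limit. -/
noncomputable def descHom (hn : 2 ≤ n) : ElemLim n →+ s.pt where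
  toFun := descFun s hn
  map_zero' := by
    rw [← map_zero (toLim hn (ofExp n 0)), descFun_toLim]
    exact map_zero (leg s _).toAddMonoidHom
  map_add' d e := by
    obtain ⟨A, x, rfl⟩ := exists_toLim_eq hn d
    obtain ⟨B, y, rfl⟩ := exists_toLim_eq hn e
    obtain ⟨D, ⟨f⟩, ⟨g⟩⟩ := exists_common hn A B
    rw [← toLim_map hn f, ← toLim_map hn g, ← map_add, descFun_toLim, descFun_toLim,
      descFun_toLim]
    exact map_add (leg s D).toAddMonoidHom _ _

/-- The morphism induced by a cocone on the limit. -/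
noncomputable def desc (hn : 2 ≤ n) : CuHom (LowerCompletion (ElemLim n)) s.pt :=
  LowerCompletion.extend (descHom s hn) (descFun_mono s hn) (descFun_below s hn)

theorem desc_principal (hn : 2 ≤ n) (d : ElemLim n) :
    desc s hn (LowerCompletion.principal d) = descFun s hn d :=
  LowerCompletion.extendFun_principal (descFun_mono s hn) d

end Descent

/-- The canonical cocone is a colimit. -/
noncomputable def isColimitLimCocone (hn : 2 ≤ n) : IsColimit (limCocone hn) where
  desc s := desc s hn
  fac s A := DFunLike.ext (F := CuHom (ElemSg A.size) s.pt) _ _ fun x =>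
    (desc_principal s hn _).trans (descFun_toLim s hn A x)
  uniq s m hm := by
    refine LowerCompletion.hom_ext (T := s.pt) fun d => ?_
    rw [desc_principal]
    obtain ⟨A, x, rfl⟩ := exists_toLim_eq hn d
    rw [descFun_toLim]
    exact DFunLike.congr_fun (F := CuHom (ElemSg A.size) s.pt) (hm A) x

/-- The canonical cocone restricts to a colimit along cofinal sequences. -/
noncomputable def isColimitWhisker (hn : 2 ≤ n) (S : ℕ ⥤ ElemCat n) [S.Final] :
    IsColimit ((limCocone hn).whisker S) :=
  (Functor.Final.isColimitWhiskerEquiv S _).symm (isColimitLimCocone hn)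

theorem isCuFraisseLimit_limObj (hn : 2 ≤ n) : IsCuFraisseLimit (elemIncl n) (limObj n) := by
  obtain ⟨S, hS⟩ := exists_isCuFraisseSequence hn
  have := final_of_isCuFraisseSequence hn hS
  exact ⟨S, hS, ((limCocone hn).whisker S).ι, ⟨isColimitWhisker hn S⟩⟩

theorem nonempty_iso_limObj (hn : 2 ≤ n) {L : CuSg} (hL : IsCuFraisseLimit (elemIncl n) L) :
    Nonempty (L ≅ limObj n) := by
  obtain ⟨S, hS, ι, ⟨h⟩⟩ := hL
  have := final_of_isCuFraisseSequence hn hS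
  exact ⟨h.coconePointUniqueUpToIso (isColimitWhisker hn S)⟩

/-! ### Properties of the limit -/

-- A nonzero ideal contains `principal d` for some `d ≠ 0`, hence its multiples, hence the top
-- element.
open LowerCompletion in
theorem isCuSimple_lim (n : ℕ) : IsCuSimple (LowerCompletion (ElemLim n)) := by
  have htop : ∀ x : LowerCompletion (ElemLim n), x ≤ principal (ElemLim.infty n) :=
    fun _ d _ => d.le_infty
  refine ⟨⟨0, principal (ElemLim.infty n), fun h => ?_⟩, fun I hI => or_iff_not_imp_left.2 ?_⟩
  · have h1 : ElemLim.infty n ≤ 0 := principal_le_principal.1 h.ge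
    exact absurd (show (2 : ℚ) ≤ 0 from h1) (by norm_num)
  · intro hI0
    have hx : ∃ x ∈ I, x ≠ 0 := by
      by_contra! h
      exact hI0 (Set.eq_singleton_iff_unique_mem.2 ⟨hI.zero_mem, h⟩)
    obtain ⟨x, hxI, hx0⟩ := hx
    have hd : ∃ d ∈ x, d ≠ 0 := by
      by_contra! h
      exact hx0 (le_antisymm (fun d hd => (h d hd).le) (CuSemigroup.cu_zero_le x))
    obtain ⟨d, hdx, hd0⟩ := hd
    obtain ⟨j, hj⟩ := ElemLim.exists_nsmul_eq_infty hd0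
    have hmul : ∀ j : ℕ, principal (j • d) ∈ I := by
      intro j
      induction j with
      | zero => rw [zero_smul]; exact hI.zero_mem
      | succ j ih =>
        rw [succ_nsmul, principal_add]
        exact hI.add_mem _ ih _ (hI.lower _ _ (principal_le_iff.2 hdx) hxI)
    exact Set.eq_univ_of_forall fun y => hI.lower _ _ (htop y) (hj ▸ hmul j)

open LowerCompletion in
theorem not_isStablyFinite_lim (n : ℕ) : ¬ IsStablyFinite (LowerCompletion (ElemLim n)) := by
  intro h
  refine h (principal (ElemLim.infty n)) ⟨_, principal_below _⟩ (principal (ElemLim.infty n))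
    (fun h0 => ?_) ?_
  · have h1 : ElemLim.infty n ≤ 0 := principal_le_principal.1 h0.le
    exact absurd (show (2 : ℚ) ≤ 0 from h1) (by norm_num)
  · rw [← principal_add, ElemLim.infty_add_infty]

theorem not_isWeaklyPurelyInfinite_lim (hn : 2 ≤ n) :
    ¬ IsWeaklyPurelyInfinite (LowerCompletion (ElemLim n)) := by
  rintro ⟨m, hm, h⟩
  -- The exponent ensures `2 * m < n ^ (2 * m)`, so neither `m • 1` nor `(2 * m) • 1` is truncated
  -- in `E_{n^{2m}}`.
  let A := ofExp n (2 * m)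
  have hA : 2 * m < A.size := Nat.lt_pow_self hn
  have h1 := h (toLimObj hn A 1)
  rw [← smul_assoc] at h1
  have hmap : ∀ j : ℕ, j • toLimObj hn A 1 = toLimObj hn A (j • 1) :=
    fun j => (map_nsmul (toLimObj hn A).toAddMonoidHom j 1).symm
  rw [hmap, hmap, toLimObj_apply, toLimObj_apply] at h1
  have h2 := (toLim_le_iff hn A).1 (LowerCompletion.principal_le_principal.1 h1.ge)
  rw [ElemSg.le_iff, ElemSg.val_nsmul, ElemSg.val_nsmul, ElemSg.val_one, smul_eq_mul] at h2
  omega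

end ElemCat

/-! ### Invariance under isomorphism -/

namespace CuSg

variable {L M : CuSg}

/-- The morphism underlying a morphism of the category. -/
def toHom (f : L ⟶ M) : CuHom L M := f

variable (e : L ≅ M)

theorem hom_inv_apply (x : L) : toHom e.inv (toHom e.hom x) = x :=
  DFunLike.congr_fun (F := CuHom L L) e.hom_inv_id x

theorem map_zero' (f : CuHom L M) : f 0 = 0 := map_zero f.toAddMonoidHom

theorem map_add' (f : CuHom L M) (x y : L) : f (x + y) = f x + f y := map_add f.toAddMonoidHom x y

theorem map_nsmul' (f : CuHom L M) (j : ℕ) (x : L) : f (j • x) = j • f x :=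
  map_nsmul f.toAddMonoidHom j x

theorem hom_injective : Function.Injective (toHom e.hom) :=
  Function.LeftInverse.injective (hom_inv_apply e)

theorem hom_le_iff {x y : L} : toHom e.hom x ≤ toHom e.hom y ↔ x ≤ y := by
  refine ⟨fun h => ?_, fun h => (toHom e.hom).monotone' h⟩
  have := (toHom e.inv).monotone' h
  rw [← hom_inv_apply e x, ← hom_inv_apply e y]
  exact this

theorem isCuIdeal_preimage (f : CuHom L M) {I : Set M} (hI : IsCuIdeal I) :
    IsCuIdeal (f ⁻¹' I) where
  zero_mem := by
    rw [Set.mem_preimage, map_zero']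
    exact hI.zero_mem
  add_mem x hx y hy := by
    rw [Set.mem_preimage, map_add']
    exact hI.add_mem _ hx _ hy
  lower x y h hy := hI.lower _ _ (f.monotone' h) hy
  sup_mem z hz hzI s hs := hI.sup_mem _ (f.monotone'.comp hz) hzI _ (f.map_isLUB' z hz s hs)

theorem isCuSimple_of_iso (e : L ≅ M) (h : IsCuSimple M) : IsCuSimple L := by
  refine ⟨?_, fun I hI => ?_⟩
  · have := h.1
    exact (hom_injective e.symm).nontrivial
  · have hpre : I = toHom e.hom ⁻¹' (toHom e.inv ⁻¹' I) := by
      ext x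
      rw [Set.mem_preimage, Set.mem_preimage, hom_inv_apply]
    rcases h.2 _ (isCuIdeal_preimage (toHom e.inv) hI) with h0 | h0
    · left
      rw [hpre, h0]
      ext x
      rw [Set.mem_preimage, Set.mem_singleton_iff, Set.mem_singleton_iff,
        ← map_zero' (toHom e.hom), (hom_injective e).eq_iff]
    · right
      rw [hpre, h0, Set.preimage_univ]

theorem isStablyFinite_of_iso (e : L ≅ M) (h : IsStablyFinite M) : IsStablyFinite L := by
  rintro x ⟨z, hz⟩ y hy hxy
  refine h (toHom e.hom x) ⟨_, (toHom e.hom).map_below' _ _ hz⟩ (toHom e.hom y) (fun h0 => ?_) ?_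
  · exact hy (hom_injective e (h0.trans (map_zero' _).symm))
  · rw [← map_add', ← hxy]

theorem isWeaklyPurelyInfinite_of_iso (e : L ≅ M) (h : IsWeaklyPurelyInfinite M) :
    IsWeaklyPurelyInfinite L := by
  obtain ⟨m, hm, h⟩ := h
  refine ⟨m, hm, fun x => hom_injective e ?_⟩
  rw [map_nsmul', map_nsmul', map_nsmul']
  exact h _

end CuSg

theorem mainTheorem9 (n : ℕ) (hn : 2 ≤ n) :
    IsCuFraisseCategory (elemIncl n) ∧
    (∃ L : CuSg, IsCuFraisseLimit (elemIncl n) L) ∧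
    (∀ L L' : CuSg, IsCuFraisseLimit (elemIncl n) L → IsCuFraisseLimit (elemIncl n) L' →
      Nonempty (L ≅ L')) ∧
    ∀ L : CuSg, IsCuFraisseLimit (elemIncl n) L →
      IsCuSimple L ∧ (∀ x y : L, x ≤ y ∨ y ≤ x) ∧
      ¬ IsStablyFinite L ∧ ¬ IsWeaklyPurelyInfinite L := by
  refine ⟨ElemCat.isCuFraisseCategory hn, ⟨_, ElemCat.isCuFraisseLimit_limObj hn⟩,
    fun L L' hL hL' => ?_, fun L hL => ?_⟩
  · obtain ⟨e⟩ := ElemCat.nonempty_iso_limObj hn hL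
    obtain ⟨e'⟩ := ElemCat.nonempty_iso_limObj hn hL'
    exact ⟨e ≪≫ e'.symm⟩
  · obtain ⟨e⟩ := ElemCat.nonempty_iso_limObj hn hL
    refine ⟨CuSg.isCuSimple_of_iso e (ElemCat.isCuSimple_lim n), fun x y => ?_,
      fun h => ElemCat.not_isStablyFinite_lim n (CuSg.isStablyFinite_of_iso e.symm h),
      fun h => ElemCat.not_isWeaklyPurelyInfinite_lim hn
        (CuSg.isWeaklyPurelyInfinite_of_iso e.symm h)⟩
    rw [← CuSg.hom_le_iff e, ← CuSg.hom_le_iff e]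
    exact LowerCompletion.le_total' _ _
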